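/- Let $G=(V,E)$ be a connected undirected simple graph on $n\ge 2$ vertices, known to the algorithm. Given oracle access to an unknown function $f:V\to\mathbb{R}$ (each query reveals $f(v)$ for one vertex $v$), the local search problem on $G$ is to find a vertex $v$ with $f(v)\le f(u)$ for all $\{u,v\}\in E$. Its randomized query complexity $R(G)$ is the infimum, over all randomized adaptive query algorithms that output a correct vertex with probability at least $9/10$ on every input $f$, of the expected number of queries on a worst-case input, $\sup_{f}\mathbb{E}[\#\text{queries on } f]$, where the expectation is over the coin tosses of the algorithm. Let $d(u)$ be the degree of $u$, and let $d_{\max}$ and $d_{\min}$ be the maximum and minimum degree of $G$. Let $\mathcal{P}$ be the transition matrix of the simple lazy random walk on $G$: $\mathcal{P}_{u,u}=1/2$, $\mathcal{P}_{u,v}=1/(2d(u))$ if $\{u,v\}\in E$, and $\mathcal{P}_{u,v}=0$ otherwise; let $\lambda_2$ be its second largest eigenvalue, counted with multiplicity. For every constant $C>0$ there is a constant $c>0$, depending only on $C$, such that for every such graph $G$ (with any number $n\ge2$ of vertices) with $d_{\max}/d_{\min}\le C$, $$R(G)\;\ge\; c\cdot\frac{(1-\lambda_2)\sqrt{n}}{\log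 n},$$ that is, the randomized query complexity of local search on $G$ is $\Omega\left(\frac{(1-\lambda_2)\sqrt n}{\log n}\right)$. -/

import Mathlib

open scoped ENNReal
open MeasureTheory

namespace LocalSearch

/-- `v` is a local minimum of `f` on `G`: `f v ≤ f u` for every edge `{u, v}`. -/
def IsLocalMinimum {V : Type*} (G : SimpleGraph V) (f : V → ℝ) (v : V) : Prop :=
  ∀ u, G.Adj v u → f v ≤ f u

/-- A deterministic adaptive query algorithm (decision tree) with oracle access to a function
`f : V → ℝ`: it either stops and outputs a vertex, or queries the value at a vertex and continues
in a way that depends on the answer. -/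
inductive DetAlg (V : Type*) where
  | output (v : V) : DetAlg V
  | query (v : V) (next : ℝ → DetAlg V) : DetAlg V

namespace DetAlg

variable {V : Type*}

/-- The vertex returned when the oracle is `f`. -/
def result (f : V → ℝ) : DetAlg V → V
  | output v => v
  | query v next => result f (next (f v))

/-- The number of oracle queries made when the oracle is `f`. -/
def cost (f : V → ℝ) : DetAlg V → ℕ
  | output _ => 0
  | query v next => cost f (next (f v)) + 1

end DetAlg

/-- A randomized query algorithm: a random deterministic one, depending on coin tosses `ω` drawn
from some probability space. On each fixed input, the vertex returned and the number of queries
are random variables. -/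
structure RandAlg (V : Type*) where
  /-- the space of coin tosses -/
  Ω : Type
  /-- its measurable sets -/
  mΩ : MeasurableSpace Ω
  /-- the law of the coin tosses -/
  μ : Measure Ω
  isProb : IsProbabilityMeasure μ
  /-- the deterministic algorithm executed when the coin tosses are `ω` -/
  alg : Ω → DetAlg V
  measurableSet_result : ∀ (f : V → ℝ) (v : V), MeasurableSet {ω | (alg ω).result f = v}
  measurableSet_cost : ∀ (f : V → ℝ) (k : ℕ), MeasurableSet {ω | (alg ω).cost f = k}

namespace RandAlg

variable {V : Type*}

/-- The expected number of queries on input `f`. -/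
noncomputable def expectedCost (A : RandAlg V) (f : V → ℝ) : ℝ≥0∞ :=
  @lintegral A.Ω A.mΩ A.μ fun ω => ((A.alg ω).cost f : ℝ≥0∞)

/-- On every input, the algorithm returns a local minimum with probability at least `9/10`. -/
def SolvesLocalSearch (A : RandAlg V) (G : SimpleGraph V) : Prop :=
  ∀ f : V → ℝ, (9 / 10 : ℝ≥0∞) ≤ A.μ {ω | IsLocalMinimum G f ((A.alg ω).result f)}

end RandAlg

/-- The randomized query complexity of local search on `G`: the least expected number of queries,
on a worst-case input, of a randomized algorithm that finds a local minimum with probability at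
least `9/10` on every input. -/
noncomputable def randQueryComplexity {V : Type*} (G : SimpleGraph V) : ℝ≥0∞ :=
  ⨅ (A : RandAlg V) (_ : A.SolvesLocalSearch G), ⨆ f : V → ℝ, A.expectedCost f

/-- The transition matrix of the simple lazy random walk on `G`: stay put with probability `1/2`,
otherwise move to a uniformly random neighbour. -/
noncomputable def lazyWalk {V : Type*} [Fintype V] [DecidableEq V] (G : SimpleGraph V)
    [DecidableRel G.Adj] : Matrix V V ℝ :=
  fun u v => if u = v then 1 / 2 else if G.Adj u v then 1 / (2 * (G.degree u : ℝ)) else 0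

/-- The second largest real eigenvalue of a matrix, eigenvalues being repeated according to their
algebraic multiplicity (and `0` if there are fewer than two). -/
noncomputable def secondEigenvalue {V : Type*} [Fintype V] [DecidableEq V]
    (P : Matrix V V ℝ) : ℝ :=
  (P.charpoly.roots.sort (· ≥ ·)).getD 1 0

end LocalSearch

namespace LocalSearch

/-! ### Inputs that hide a path. -/

section Paths

variable {V : Type*}

/-! The hard inputs hide a lazy random walk of length `L`: a visited vertex gets minus the time of
its last visit, any other vertex its distance to the start. The walk descends, the distance leads
back to it, so the endpoint is the only local minimum (`eq_of_isLocalMinimum`). As the endpoint is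
known exactly when the algorithm succeeds, it remains to bound the success probability of each
deterministic algorithm on a random walk and to average over coin tosses.

Let `t` be a time after which every vertex has probability at most `ρ`, and let `m` be the last time
of the walk discovered so far. If each query raised `m` by at most `t`, then `q` queries and the
output could not reach `L > (q + 1) * t`; so some examined vertex is `x j` with `j > m + t`
(`DetAlg.exists_probe_ahead`). A union bound over the query index, `m` and `j` makes this unlikely
(`walkExp_success_le`). While the discovered time is at most `m`, the algorithm can be simulated
from the walk up to `m`, so each pair `(m, j)` costs at most `ρ`; this is affordable for the `t`
values of `j` next to `m + t`. For `j > m + 2t` one keeps the event that the discovered time is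
exactly `m`, which the walk up to `m + t` determines; these events are disjoint, so all `m` together
cost `L * ρ`. The total is `(q + 1) * L * (t + 1) * ρ`.

A spectral estimate (`lazyWalk_pow_apply_le`) gives `ρ = 2C / n` for `t` about `log n / (1 - λ₂)`,
so the bound stays small up to `q` of order `√n / t`. -/

lemma exists_adj_dist_lt {G : SimpleGraph V} (hG : G.Connected) {u v : V} (h : v ≠ u) :
    ∃ w, G.Adj v w ∧ G.dist u w < G.dist u v := by
  obtain ⟨p, hp⟩ := hG.exists_walk_length_eq_dist v u
  cases p with
  | nil => exact absurd rfl h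
  | cons hadj p' =>
    refine ⟨_, hadj, ?_⟩
    rw [SimpleGraph.dist_comm, SimpleGraph.dist_comm (u := u), ← hp, SimpleGraph.Walk.length_cons]
    exact Nat.lt_succ_of_le (SimpleGraph.dist_le p')

variable [DecidableEq V]

/-- The last positive time `i ≤ K` at which the path `x` visits `v`, and `0` if there is none. -/
def lastVisit (x : ℕ → V) (K : ℕ) (v : V) : ℕ :=
  Nat.findGreatest (fun i => x i = v) K

lemma lastVisit_le (x : ℕ → V) (K : ℕ) (v : V) : lastVisit x K v ≤ K :=
  Nat.findGreatest_le K

lemma le_lastVisit (x : ℕ → V) {K i : ℕ} (hi : i ≤ K) : i ≤ lastVisit x K (x i) :=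
  Nat.le_findGreatest hi rfl

lemma apply_lastVisit (x : ℕ → V) {K : ℕ} {v : V} (h : lastVisit x K v ≠ 0) :
    x (lastVisit x K v) = v :=
  Nat.findGreatest_of_ne_zero (P := fun i => x i = v) rfl h

lemma lastVisit_congr {x y : ℕ → V} {K : ℕ} (h : ∀ i ≤ K, x i = y i) (v : V) :
    lastVisit x K v = lastVisit y K v := by
  unfold lastVisit
  rw [Nat.findGreatest_eq_iff]
  refine ⟨Nat.findGreatest_le K, fun h0 => ?_, fun n hn hnK => ?_⟩
  · rw [h _ (Nat.findGreatest_le K)]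
    exact Nat.findGreatest_of_ne_zero (P := fun i => y i = v) rfl h0
  · rw [h _ hnK]
    exact Nat.findGreatest_is_greatest hn hnK

lemma lastVisit_eq_of_forall_ne {x : ℕ → V} {K K' : ℕ} {v : V} (hK : K ≤ K')
    (h : ∀ j, K < j → j ≤ K' → x j ≠ v) : lastVisit x K' v = lastVisit x K v := by
  unfold lastVisit
  rw [Nat.findGreatest_eq_iff]
  refine ⟨(Nat.findGreatest_le K).trans hK, fun h0 => ?_, fun n hn hnK => ?_⟩
  · exact Nat.findGreatest_of_ne_zero (P := fun i => x i = v) rfl h0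
  · rcases le_or_gt n K with h1 | h1
    · exact Nat.findGreatest_is_greatest hn h1
    · exact h n h1 hnK

/-- A cutoff at or after the last visit removes no visit; this is what allows simulation from a
shorter path. -/
lemma lastVisit_min_eq {x : ℕ → V} {K K' : ℕ} {v : V} (h : lastVisit x K' v ≤ K) :
    lastVisit x (min K K') v = lastVisit x K' v := by
  rcases le_total K' K with h1 | h1
  · rw [min_eq_right h1]
  · rw [min_eq_left h1]
    refine (lastVisit_eq_of_forall_ne h1 fun j hj hj' hx => ?_).symm
    have := le_lastVisit x hj'
    rw [hx] at this
    omega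

/-- The value at `v` of the input hiding the path `x`, cut off at time `K`: minus the time of the
last visit to `v`, and `h v` if there is no visit at a positive time. -/
noncomputable def pathValue (h : V → ℝ) (x : ℕ → V) (K : ℕ) (v : V) : ℝ :=
  if lastVisit x K v = 0 then h v else -(lastVisit x K v : ℝ)

lemma pathValue_congr (h : V → ℝ) {x y : ℕ → V} {K K' : ℕ} {v : V}
    (hl : lastVisit x K v = lastVisit y K' v) : pathValue h x K v = pathValue h y K' v := by
  simp only [pathValue, hl]

lemma pathValue_le (h : V → ℝ) (x : ℕ → V) (K : ℕ) {v : V} (hv : 0 ≤ h v) :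
    pathValue h x K v ≤ h v := by
  unfold pathValue
  split_ifs
  · rfl
  · have : (0 : ℝ) ≤ lastVisit x K v := Nat.cast_nonneg _
    linarith

lemma pathValue_apply_le (h : V → ℝ) (x : ℕ → V) {K i : ℕ} (hi : i ≤ K) (h0 : i ≠ 0) :
    pathValue h x K (x i) ≤ -(i : ℝ) := by
  have h1 := le_lastVisit x hi
  have h2 : (i : ℝ) ≤ lastVisit x K (x i) := by exact_mod_cast h1
  rw [pathValue, if_neg (by omega)]
  linarith

/-- The only local minimum of the input hiding a lazy walk is the endpoint of the walk. -/
lemma eq_of_isLocalMinimum {G : SimpleGraph V} (hG : G.Connected) {x : ℕ → V} {L : ℕ}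
    (hx : ∀ i < L, x i = x (i + 1) ∨ G.Adj (x i) (x (i + 1))) {v : V}
    (hv : IsLocalMinimum G (pathValue (fun u => (G.dist (x 0) u : ℝ)) x L) v) : v = x L := by
  by_contra hne
  have key : ∀ i ≤ L, x i = v → (∀ j, i < j → j ≤ L → x j ≠ v) →
      pathValue (fun u => (G.dist (x 0) u : ℝ)) x L v = -(i : ℝ) → False := by
    intro i hi hxi hlast hval
    have hiL : i < L := lt_of_le_of_ne hi fun h => hne (by rw [← hxi, h])
    have hnext := hlast (i + 1) (Nat.lt_succ_self i) hiL
    have hadj : G.Adj v (x (i + 1)) := by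
      rcases hx i hiL with h | h
      · exact absurd (h.symm.trans hxi) hnext
      · rwa [hxi] at h
    have h1 := hv _ hadj
    have h2 := pathValue_apply_le (fun u => (G.dist (x 0) u : ℝ)) x (K := L) (i := i + 1) hiL
      (Nat.succ_ne_zero i)
    rw [hval] at h1
    push_cast at h2
    linarith
  by_cases h0 : lastVisit x L v = 0
  · have hval : pathValue (fun u => (G.dist (x 0) u : ℝ)) x L v = G.dist (x 0) v := by
      rw [pathValue, if_pos h0]
    by_cases hv0 : v = x 0
    -- The default value `0` of `lastVisit` is harmless at the start: its distance to itself is `0`,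
    -- which is also minus the time `0`.
    · refine key 0 (Nat.zero_le _) hv0.symm (fun j hj hjL hxj => ?_) (by rw [hval, hv0]; simp)
      have := le_lastVisit x hjL
      rw [hxj] at this
      omega
    · obtain ⟨w, hadj, hlt⟩ := exists_adj_dist_lt hG hv0
      have h1 := hv w hadj
      have h2 := pathValue_le (fun u => (G.dist (x 0) u : ℝ)) x L (v := w) (Nat.cast_nonneg _)
      have h3 : (G.dist (x 0) w : ℝ) < G.dist (x 0) v := by exact_mod_cast hlt
      rw [hval] at h1
      exact absurd (h1.trans h2) (not_le.2 h3)
  · refine key _ (lastVisit_le x L v) (apply_lastVisit x h0) (fun j hj hjL hxj => ?_)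
      (by rw [pathValue, if_neg h0])
    have := le_lastVisit x hjL
    rw [hxj] at this
    omega

end Paths

/-! ### Simulating an algorithm with a truncated path. -/

namespace DetAlg

variable {V : Type*}

/-- The vertex that the algorithm is about to query or to return. -/
def head : DetAlg V → V
  | output v => v
  | query v _ => v

variable [DecidableEq V]

/-- The vertex that the algorithm examines after `s` queries, together with the last time of the
path `x` discovered so far, when `m` was discovered at the start. With discovered time `m`, the
oracle answers as if the path were cut off at time `min K (m + t)`. -/
noncomputable def probe (h : V → ℝ) (x : ℕ → V) (t K : ℕ) : ℕ → DetAlg V → ℕ → V × ℕ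
  | 0, a, m => (a.head, m)
  | _ + 1, output v, m => (v, m)
  | s + 1, query v next, m =>
    probe h x t K s (next (pathValue h x (min K (m + t)) v))
      (max m (lastVisit x (min K (m + t)) v))

variable {h : V → ℝ} {x y : ℕ → V} {t K : ℕ}

/-- Discovered time never decreases, so its final value controls every earlier cutoff. -/
lemma le_probe_snd (s : ℕ) (a : DetAlg V) (m : ℕ) : m ≤ (probe h x t K s a m).2 := by
  induction s generalizing a m with
  | zero => exact le_rfl
  | succ s ih =>
    cases a with
    | output v => exact le_rfl
    | query v next => exact (le_max_left _ _).trans (ih _ _)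

/-- What the algorithm does while the discovered time is at most `m` depends only on the path up
to time `m + t`. -/
lemma probe_congr (s : ℕ) (a : DetAlg V) (m₀ : ℕ)
    (hxy : ∀ i ≤ (probe h x t K s a m₀).2 + t, x i = y i) :
    probe h y t K s a m₀ = probe h x t K s a m₀ := by
  induction s generalizing a m₀ with
  | zero => rfl
  | succ s ih =>
    cases a with
    | output v => rfl
    | query v next =>
      have hm : m₀ ≤ (probe h x t K (s + 1) (query v next) m₀).2 := le_probe_snd _ _ _
      have hl : lastVisit y (min K (m₀ + t)) v = lastVisit x (min K (m₀ + t)) v :=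
        lastVisit_congr (fun i hi => (hxy i (by omega)).symm) v
      simp only [probe] at hxy ⊢
      rw [hl, pathValue_congr h hl]
      exact ih _ _ hxy

/-- What the algorithm does while the discovered time is at most `m` can be simulated with the
path up to time `m`. -/
lemma probe_truncate (s : ℕ) (a : DetAlg V) (m₀ : ℕ) {m : ℕ} (hK : m ≤ K)
    (hm : (probe h x t K s a m₀).2 = m) :
    probe h x t m s a m₀ = probe h x t K s a m₀ := by
  induction s generalizing a m₀ with
  | zero => rfl
  | succ s ih =>
    cases a with
    | output v => rfl
    | query v next =>
      simp only [probe] at hm ⊢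
      -- Every visit reported on the way lies at or before the final discovered time `m`, so
      -- truncation at `m` leaves all answers unchanged.
      have h1 : max m₀ (lastVisit x (min K (m₀ + t)) v) ≤ m := hm ▸ le_probe_snd _ _ _
      have hl : lastVisit x (min m (m₀ + t)) v = lastVisit x (min K (m₀ + t)) v := by
        rw [← lastVisit_min_eq (K := m) (K' := min K (m₀ + t)) ((le_max_right _ _).trans h1)]
        congr 1
        omega
      rw [hl, pathValue_congr h hl]
      exact ih _ _ hm

/-- All answers use cutoffs at most `K`. Applied with `K = m`, it shows that the truncated
simulation is determined by the path up to `m`, whatever time it discovers. -/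
lemma probe_fst_congr (s : ℕ) (a : DetAlg V) (m₀ : ℕ) (hxy : ∀ i ≤ K, x i = y i) :
    probe h y t K s a m₀ = probe h x t K s a m₀ := by
  induction s generalizing a m₀ with
  | zero => rfl
  | succ s ih =>
    cases a with
    | output v => rfl
    | query v next =>
      have hl : lastVisit y (min K (m₀ + t)) v = lastVisit x (min K (m₀ + t)) v :=
        lastVisit_congr (fun i hi => (hxy i (by omega)).symm) v
      simp only [probe]
      rw [hl, pathValue_congr h hl]
      exact ih _ _

/-- An algorithm that finds the end of a long path with few queries must examine a vertex far
ahead of the discovered part of the path. -/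
lemma exists_probe_ahead {L : ℕ} (a : DetAlg V) (q m : ℕ)
    (hcost : a.cost (pathValue h x L) ≤ q) (hres : a.result (pathValue h x L) = x L)
    (hL : m + (q + 1) * t < L) :
    ∃ s ≤ q, ∃ j, (probe h x t L s a m).2 + t < j ∧ j ≤ L ∧
      x j = (probe h x t L s a m).1 := by
  induction a generalizing q m with
  | output v =>
    -- The returned vertex counts as one more examined vertex, hence `q + 1` rather than `q`.
    refine ⟨0, Nat.zero_le _, L, ?_, le_rfl, hres.symm⟩
    simp only [probe]
    rw [Nat.succ_mul] at hL
    omega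
  | query v next ih =>
    by_cases hj : ∃ j, m + t < j ∧ j ≤ L ∧ x j = v
    · exact ⟨0, Nat.zero_le _, hj⟩
    -- Without a visit to `v` after `m + t`, the true answer is the truncated one, and the
    -- discovered time grows by at most `t`, the allowance of one query.
    push Not at hj
    obtain ⟨q, rfl⟩ : ∃ q', q = q' + 1 := by
      cases q with
      | zero => simp [cost] at hcost
      | succ q => exact ⟨q, rfl⟩
    rw [Nat.succ_mul] at hL
    have hmL : min L (m + t) = m + t := by omega
    have hl : lastVisit x L v = lastVisit x (m + t) v :=
      lastVisit_eq_of_forall_ne (by omega) hj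
    have hval := pathValue_congr h hl
    have h1 : max m (lastVisit x (m + t) v) ≤ m + t :=
      max_le (Nat.le_add_right _ _) (lastVisit_le _ _ _)
    obtain ⟨s, hs, j, hj1, hj2, hj3⟩ := ih (pathValue h x L v) q (max m (lastVisit x (m + t) v))
      (by simpa [cost] using hcost) hres (by omega)
    refine ⟨s + 1, by omega, j, ?_⟩
    simp only [probe, hmL, ← hval]
    exact ⟨hj1, hj2, hj3⟩

end DetAlg

/-! ### Expectations over random paths. -/

section WalkExp

variable {V : Type*} [Fintype V]

/-- The expectation of `F` over the path obtained from `x` by resampling the positions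
`m + 1, …, m + d` as steps of the Markov chain with transition weights `w`. -/
noncomputable def walkExp (w : V → V → ℝ≥0∞) :
    ℕ → ℕ → ((ℕ → V) → ℝ≥0∞) → (ℕ → V) → ℝ≥0∞
  | 0, _, F, x => F x
  | d + 1, m, F, x => ∑ v, w (x m) v * walkExp w d (m + 1) F (Function.update x (m + 1) v)

variable {w : V → V → ℝ≥0∞}

lemma walkExp_mono {F H : (ℕ → V) → ℝ≥0∞} (hFH : ∀ x, F x ≤ H x) (d m : ℕ) (x : ℕ → V) :
    walkExp w d m F x ≤ walkExp w d m H x := by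
  induction d generalizing m x with
  | zero => exact hFH x
  | succ d ih => exact Finset.sum_le_sum fun v _ => mul_le_mul_right (ih _ _) _

lemma walkExp_sum {ι : Type*} (s : Finset ι) (F : ι → (ℕ → V) → ℝ≥0∞) (d m : ℕ) (x : ℕ → V) :
    walkExp w d m (fun y => ∑ i ∈ s, F i y) x = ∑ i ∈ s, walkExp w d m (F i) x := by
  induction d generalizing m x with
  | zero => rfl
  | succ d ih =>
    simp only [walkExp, ih, Finset.mul_sum]
    exact Finset.sum_comm

lemma walkExp_add (F H : (ℕ → V) → ℝ≥0∞) (d m : ℕ) (x : ℕ → V) :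
    walkExp w d m (fun y => F y + H y) x = walkExp w d m F x + walkExp w d m H x := by
  induction d generalizing m x with
  | zero => rfl
  | succ d ih => simp only [walkExp, ih, mul_add, Finset.sum_add_distrib]

/-- A factor determined by the path up to time `m` can be taken out. -/
lemma walkExp_mul_left {F H : (ℕ → V) → ℝ≥0∞} {m : ℕ}
    (hF : ∀ x y : ℕ → V, (∀ i ≤ m, x i = y i) → F x = F y) (d : ℕ) (x : ℕ → V) :
    walkExp w d m (fun y => F y * H y) x = F x * walkExp w d m H x := by
  induction d generalizing m x with
  | zero => rfl
  | succ d ih =>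
    simp only [walkExp, Finset.mul_sum]
    refine Finset.sum_congr rfl fun v _ => ?_
    rw [ih fun x y hxy => hF x y fun i hi => hxy i (hi.trans (Nat.le_succ m)),
      hF (Function.update x (m + 1) v) x fun i hi => Function.update_of_ne (by omega) _ _]
    ring

lemma walkExp_const (hw : ∀ u, ∑ v, w u v = 1) (c : ℝ≥0∞) (d m : ℕ) (x : ℕ → V) :
    walkExp w d m (fun _ => c) x = c := by
  induction d generalizing m x with
  | zero => rfl
  | succ d ih => simp only [walkExp, ih, ← Finset.sum_mul, hw, one_mul]

lemma walkExp_of_determined (hw : ∀ u, ∑ v, w u v = 1) {F : (ℕ → V) → ℝ≥0∞} {m : ℕ}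
    (hF : ∀ x y : ℕ → V, (∀ i ≤ m, x i = y i) → F x = F y) (d : ℕ) (x : ℕ → V) :
    walkExp w d m F x = F x := by
  have := walkExp_mul_left (w := w) (H := fun _ => 1) hF d x
  simpa [walkExp_const hw] using this

/-- The tower property: it conditions on the path up to time `m + d`. -/
lemma walkExp_walkExp (F : (ℕ → V) → ℝ≥0∞) (d e m : ℕ) (x : ℕ → V) :
    walkExp w (d + e) m F x = walkExp w d m (walkExp w e (m + d) F) x := by
  induction d generalizing m x with
  | zero => simp [walkExp]
  | succ d ih =>
    rw [Nat.succ_add]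
    simp only [walkExp, ih]
    rw [show m + 1 + d = m + (d + 1) by omega]

/-- The expectation of a function is at least `c` if it is at least `c` on every possible path. -/
lemma le_walkExp (hw : ∀ u, ∑ v, w u v = 1) {F : (ℕ → V) → ℝ≥0∞} {c : ℝ≥0∞} (d m : ℕ)
    (x : ℕ → V)
    (hF : ∀ y : ℕ → V, (∀ i ≤ m, y i = x i) →
      (∀ i, m ≤ i → i < m + d → w (y i) (y (i + 1)) ≠ 0) → c ≤ F y) :
    c ≤ walkExp w d m F x := by
  induction d generalizing m x with
  | zero => exact hF x (fun _ _ => rfl) fun i h1 h2 => by omega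
  | succ d ih =>
    calc c = ∑ v, w (x m) v * c := by rw [← Finset.sum_mul, hw, one_mul]
      _ ≤ _ := Finset.sum_le_sum fun v _ => ?_
    by_cases h0 : w (x m) v = 0
    · simp [h0]
    refine mul_le_mul_right (ih _ _ fun y hy hstep => hF y (fun i hi => ?_) fun i h1 h2 => ?_) _
    · rw [hy i (by omega), Function.update_of_ne (by omega)]
    · rcases h1.eq_or_lt with rfl | h1
      · rw [hy _ (Nat.le_succ m), hy _ le_rfl, Function.update_of_ne (by omega),
          Function.update_self]
        exact h0
      · exact hstep i h1 (by omega)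

/-- The expectation over paths commutes with integration over coin tosses. -/
lemma walkExp_lintegral {Ω : Type*} [MeasurableSpace Ω] (μ : Measure Ω)
    {F : (ℕ → V) → Ω → ℝ≥0∞} (hF : ∀ x, Measurable (F x)) (d m : ℕ) (x : ℕ → V) :
    Measurable (fun ω => walkExp w d m (fun y => F y ω) x) ∧
    walkExp w d m (fun y => ∫⁻ ω, F y ω ∂μ) x = ∫⁻ ω, walkExp w d m (fun y => F y ω) x ∂μ := by
  induction d generalizing m x with
  | zero => exact ⟨hF x, rfl⟩
  | succ d ih =>
    have hm : ∀ v, Measurable fun ω =>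
        w (x m) v * walkExp w d (m + 1) (fun y => F y ω) (Function.update x (m + 1) v) :=
      fun v => (ih _ _).1.const_mul _
    refine ⟨Finset.measurable_sum _ fun v _ => hm v, ?_⟩
    simp only [walkExp]
    rw [lintegral_finsetSum _ fun v _ => hm v]
    refine Finset.sum_congr rfl fun v _ => ?_
    rw [(ih _ _).2, lintegral_const_mul _ (ih _ _).1]

variable [DecidableEq V]

/-- After at least `t` fresh steps, a vertex chosen beforehand is hit with probability at most
`ρ`. -/
lemma walkExp_hit_le (hw : ∀ u, ∑ v, w u v = 1) {ρ : ℝ≥0∞} {t : ℕ}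
    (hρ : ∀ d, t ≤ d → ∀ m v x, walkExp w d m (fun y => if y (m + d) = v then 1 else 0) x ≤ ρ)
    {F : (ℕ → V) → ℝ≥0∞} {c : (ℕ → V) → V} {k j L : ℕ} (hkj : k + t ≤ j) (hjL : j ≤ L)
    (hF : ∀ x y : ℕ → V, (∀ i ≤ k, x i = y i) → F x = F y)
    (hc : ∀ x y : ℕ → V, (∀ i ≤ k, x i = y i) → c x = c y) (x : ℕ → V) :
    walkExp w L 0 (fun y => F y * if y j = c y then 1 else 0) x ≤ ρ * walkExp w L 0 F x := by
  obtain ⟨d, rfl⟩ := Nat.exists_eq_add_of_le (show k ≤ j by omega)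
  obtain ⟨e, rfl⟩ := Nat.exists_eq_add_of_le hjL
  rw [add_assoc, walkExp_walkExp, walkExp_walkExp (F := F), zero_add]
  have hconst : ρ * walkExp w k 0 (walkExp w (d + e) k F) x =
      walkExp w k 0 (fun y => ρ * walkExp w (d + e) k F y) x :=
    (walkExp_mul_left (F := fun _ => ρ) (fun _ _ _ => rfl) k x).symm
  rw [hconst]
  refine walkExp_mono (fun y => ?_) _ _ _
  rw [walkExp_mul_left hF, walkExp_of_determined hw hF, mul_comm ρ]
  refine mul_le_mul_right ?_ _
  -- Resampling after time `k` does not change `c`, so the random target can be frozen at `c y`. The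
  -- indicator of `c z = c y` is inserted as a factor determined at time `k`, with value `1` at `y`.
  have hfix : walkExp w (d + e) k (fun z => if z (k + d) = c z then (1 : ℝ≥0∞) else 0) y =
      walkExp w (d + e) k (fun z => if z (k + d) = c y then (1 : ℝ≥0∞) else 0) y := by
    have h1 := walkExp_mul_left (w := w) (m := k)
      (F := fun z => if c z = c y then (1 : ℝ≥0∞) else 0)
      (H := fun z => if z (k + d) = c z then (1 : ℝ≥0∞) else 0)
      (fun a b hab => by simp only [hc a b hab]) (d + e) y
    have h2 := walkExp_mul_left (w := w) (m := k)
      (F := fun z => if c z = c y then (1 : ℝ≥0∞) else 0)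
      (H := fun z => if z (k + d) = c y then (1 : ℝ≥0∞) else 0)
      (fun a b hab => by simp only [hc a b hab]) (d + e) y
    simp only [if_true, one_mul] at h1 h2
    rw [← h1, ← h2]
    congr 1
    ext z
    by_cases hz : c z = c y <;> simp [hz]
  rw [hfix, walkExp_walkExp]
  refine le_trans (walkExp_mono (fun z => ?_) _ _ _) (hρ d (by omega) k (c y) y)
  exact (walkExp_of_determined hw (fun a b hab => by simp only [hab _ le_rfl]) e z).le

/-- The law of the last of `d` fresh steps is given by the `d`-th power of the transition
matrix. -/
lemma walkExp_hit_eq {P : Matrix V V ℝ} (hP : ∀ u v, 0 ≤ P u v) (d m : ℕ) (v : V) (x : ℕ → V) :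
    walkExp (fun u v => ENNReal.ofReal (P u v)) d m (fun y => if y (m + d) = v then 1 else 0) x =
      ENNReal.ofReal ((P ^ d) (x m) v) := by
  have hpow : ∀ d u v, 0 ≤ (P ^ d) u v := by
    intro d
    induction d with
    | zero => intro u v; simp only [pow_zero, Matrix.one_apply]; split_ifs <;> simp
    | succ d ih =>
      intro u v
      rw [pow_succ, Matrix.mul_apply]
      exact Finset.sum_nonneg fun i _ => mul_nonneg (ih _ _) (hP _ _)
  induction d generalizing m x with
  | zero => simp only [walkExp, add_zero, pow_zero, Matrix.one_apply]; split_ifs <;> simp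
  | succ d ih =>
    rw [pow_succ', Matrix.mul_apply,
      ENNReal.ofReal_sum_of_nonneg fun i _ => mul_nonneg (hP _ _) (hpow _ _ _)]
    simp only [walkExp]
    refine Finset.sum_congr rfl fun u _ => ?_
    rw [ENNReal.ofReal_mul (hP _ _), show m + (d + 1) = m + 1 + d by omega, ih,
      Function.update_self]

end WalkExp

/-! ### The union bound for deterministic algorithms. -/

section DetBound

variable {V : Type*} [Fintype V] [DecidableEq V]

/-- A deterministic algorithm making at most `q` queries is unlikely to find the end of a random
path. -/
lemma walkExp_success_le {w : V → V → ℝ≥0∞} (hw : ∀ u, ∑ v, w u v = 1) {ρ : ℝ≥0∞} {t : ℕ}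
    (hρ : ∀ d, t ≤ d → ∀ m v x, walkExp w d m (fun y => if y (m + d) = v then 1 else 0) x ≤ ρ)
    (h : V → ℝ) (a : DetAlg V) {q L : ℕ} (hL : (q + 1) * t < L) (x : ℕ → V) :
    walkExp w L 0 (fun y => if a.cost (pathValue h y L) ≤ q ∧ a.result (pathValue h y L) = y L
      then 1 else 0) x ≤ (q + 1) * (L * (t + 1) * ρ) := by
  -- The event that `m` is the discovered time is dropped here: it may depend on the path up to `m +
  -- t`, and positions just after that would not be fresh. The factor `1` only matches the form of
  -- `walkExp_hit_le`.
  let near : ℕ → ℕ → ℕ → (ℕ → V) → ℝ≥0∞ := fun s m j y =>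
    1 * if y j = (DetAlg.probe h y t m s a 0).1 then 1 else 0
  let reached : ℕ → ℕ → (ℕ → V) → ℝ≥0∞ := fun s m y =>
    if (DetAlg.probe h y t L s a 0).2 = m then 1 else 0
  let far : ℕ → ℕ → ℕ → (ℕ → V) → ℝ≥0∞ := fun s m j y =>
    reached s m y * if y j = (DetAlg.probe h y t L s a 0).1 then 1 else 0
  let J₁ : ℕ → Finset ℕ := fun m => (Finset.Ioc (m + t) (m + t + t)).filter (· ≤ L)
  let J₂ : ℕ → Finset ℕ := fun m => Finset.Ioc (m + t + t) L
  have hpoint : ∀ y : ℕ → V,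
      (if a.cost (pathValue h y L) ≤ q ∧ a.result (pathValue h y L) = y L then (1 : ℝ≥0∞) else 0) ≤
      ∑ s ∈ Finset.range (q + 1), ((∑ m ∈ Finset.range L, ∑ j ∈ J₁ m, near s m j y) +
        ∑ m ∈ Finset.range L, ∑ j ∈ J₂ m, far s m j y) := by
    intro y
    split_ifs with hy
    swap
    · exact zero_le
    obtain ⟨s, hs, j, hj, hjL, hyj⟩ := DetAlg.exists_probe_ahead a q 0 hy.1 hy.2
      (by simpa using hL)
    have hsmem : s ∈ Finset.range (q + 1) := Finset.mem_range.2 (by omega)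
    refine le_trans ?_ (Finset.single_le_sum (f := fun s =>
      ((∑ m ∈ Finset.range L, ∑ j ∈ J₁ m, near s m j y) +
        ∑ m ∈ Finset.range L, ∑ j ∈ J₂ m, far s m j y)) (fun _ _ => zero_le) hsmem)
    obtain ⟨m, hm⟩ : ∃ m, (DetAlg.probe h y t L s a 0).2 = m := ⟨_, rfl⟩
    rw [hm] at hj
    have hmmem : m ∈ Finset.range L := Finset.mem_range.2 (by omega)
    rcases le_or_gt j (m + t + t) with hcase | hcase
    · refine le_trans ?_ (le_add_of_nonneg_right zero_le)
      refine le_trans ?_ (Finset.single_le_sum (f := fun m => ∑ j ∈ J₁ m, near s m j y)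
        (fun _ _ => zero_le) hmmem)
      refine le_trans ?_ (Finset.single_le_sum (f := fun j => near s m j y)
        (fun _ _ => zero_le) (show j ∈ J₁ m by simp [J₁]; omega))
      have htr := DetAlg.probe_truncate s a 0 (show m ≤ L by omega) hm
      simp [near, htr, hyj]
    · refine le_trans ?_ (le_add_of_nonneg_left zero_le)
      refine le_trans ?_ (Finset.single_le_sum (f := fun m => ∑ j ∈ J₂ m, far s m j y)
        (fun _ _ => zero_le) hmmem)
      refine le_trans ?_ (Finset.single_le_sum (f := fun j => far s m j y)
        (fun _ _ => zero_le) (show j ∈ J₂ m by simp [J₂]; omega))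
      simp [far, reached, hm, hyj]
  have hnear : ∀ s m, ∀ j ∈ J₁ m, walkExp w L 0 (near s m j) x ≤ ρ := by
    intro s m j hj
    simp only [J₁, Finset.mem_filter, Finset.mem_Ioc] at hj
    have := walkExp_hit_le hw hρ (F := fun _ => 1)
      (c := fun y => (DetAlg.probe h y t m s a 0).1) (k := m) hj.1.1.le hj.2
      (fun _ _ _ => rfl) (fun y z hyz => by rw [DetAlg.probe_fst_congr s a 0 hyz]) x
    rwa [walkExp_const hw, mul_one] at this
  have hdet : ∀ s m (y z : ℕ → V), (∀ i ≤ m + t, y i = z i) →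
      (DetAlg.probe h y t L s a 0).2 = m →
      DetAlg.probe h z t L s a 0 = DetAlg.probe h y t L s a 0 :=
    fun s m y z hyz hm => DetAlg.probe_congr s a 0 (by rwa [hm])
  have hfar : ∀ s m, ∀ j ∈ J₂ m,
      walkExp w L 0 (far s m j) x ≤ ρ * walkExp w L 0 (reached s m) x := by
    intro s m j hj
    simp only [J₂, Finset.mem_Ioc] at hj
    have hsymm : ∀ y z : ℕ → V, (∀ i ≤ m + t, y i = z i) → ∀ i ≤ m + t, z i = y i :=
      fun y z hyz i hi => (hyz i hi).symm
    have hat : ∀ y z : ℕ → V, (∀ i ≤ m + t, y i = z i) → reached s m y = reached s m z := by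
      intro y z hyz
      by_cases h1 : (DetAlg.probe h y t L s a 0).2 = m
      · simp only [reached, hdet s m y z hyz h1]
      · by_cases h2 : (DetAlg.probe h z t L s a 0).2 = m
        · simp only [reached, hdet s m z y (hsymm y z hyz) h2]
        · simp only [reached, if_neg h1, if_neg h2]
    -- Outside the event the probed vertex may depend on later positions; the arbitrary default
    -- `a.head` makes the target determined by time `m + t`.
    let c : (ℕ → V) → V := fun y =>
      if (DetAlg.probe h y t L s a 0).2 = m then (DetAlg.probe h y t L s a 0).1 else a.head
    have hc : ∀ y z : ℕ → V, (∀ i ≤ m + t, y i = z i) → c y = c z := by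
      intro y z hyz
      by_cases h1 : (DetAlg.probe h y t L s a 0).2 = m
      · simp only [c, hdet s m y z hyz h1]
      · by_cases h2 : (DetAlg.probe h z t L s a 0).2 = m
        · simp only [c, hdet s m z y (hsymm y z hyz) h2]
        · simp only [c, if_neg h1, if_neg h2]
    have := walkExp_hit_le hw hρ (F := reached s m) (c := c) (k := m + t) hj.1.le hj.2 hat hc x
    refine le_trans (walkExp_mono (fun y => ?_) _ _ _) this
    by_cases h1 : (DetAlg.probe h y t L s a 0).2 = m
    · simp [far, c, h1]
    · simp [far, reached, h1]
  -- For fixed `s` these events are disjoint, which saves a factor `L` in the far case.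
  have hsum : ∀ s, ∑ m ∈ Finset.range L, walkExp w L 0 (reached s m) x ≤ 1 := by
    intro s
    rw [← walkExp_sum]
    refine le_trans (walkExp_mono (fun y => ?_) _ _ _) (walkExp_const hw 1 L 0 x).le
    simp only [reached, Finset.sum_ite_eq]
    split_ifs <;> simp
  refine (walkExp_mono hpoint L 0 x).trans ?_
  rw [walkExp_sum]
  refine (Finset.sum_le_card_nsmul _ _ (L * (t + 1) * ρ) fun s _ => ?_).trans ?_
  · rw [walkExp_add, walkExp_sum, walkExp_sum]
    simp only [walkExp_sum]
    have h1 : ∑ m ∈ Finset.range L, ∑ j ∈ J₁ m, walkExp w L 0 (near s m j) x ≤ L * (t * ρ) := by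
      refine (Finset.sum_le_card_nsmul _ _ ((t : ℝ≥0∞) * ρ) fun m _ => ?_).trans ?_
      · refine (Finset.sum_le_card_nsmul _ _ ρ (hnear s m)).trans ?_
        rw [nsmul_eq_mul]
        refine mul_le_mul_left ?_ _
        have : (J₁ m).card ≤ t := (Finset.card_filter_le _ _).trans (by simp)
        exact_mod_cast this
      · simp
    have h2 : ∑ m ∈ Finset.range L, ∑ j ∈ J₂ m, walkExp w L 0 (far s m j) x ≤ L * ρ := by
      calc _ ≤ ∑ m ∈ Finset.range L, L * (ρ * walkExp w L 0 (reached s m) x) := by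
            refine Finset.sum_le_sum fun m _ => ?_
            refine (Finset.sum_le_card_nsmul _ _ _ (hfar s m)).trans ?_
            rw [nsmul_eq_mul]
            refine mul_le_mul_left ?_ _
            have : (J₂ m).card ≤ L := by simp [J₂]
            exact_mod_cast this
        _ = L * ρ * ∑ m ∈ Finset.range L, walkExp w L 0 (reached s m) x := by
            rw [Finset.mul_sum]; simp only [mul_assoc]
        _ ≤ L * ρ * 1 := mul_le_mul_right (hsum s) _
        _ = L * ρ := mul_one _
    calc _ ≤ (L : ℝ≥0∞) * (t * ρ) + L * ρ := add_le_add h1 h2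
      _ = _ := by ring
  · simp

end DetBound

/-! ### Powers of a symmetric matrix. -/

section Spectral

variable {V : Type*} [Fintype V] [DecidableEq V]

lemma pow_apply_eq_sum_eigenvalues {A : Matrix V V ℝ} (hA : A.IsHermitian) (t : ℕ) (u v : V) :
    (A ^ t) u v = ∑ i, (hA.eigenvectorUnitary : Matrix V V ℝ) u i * hA.eigenvalues i ^ t *
      (hA.eigenvectorUnitary : Matrix V V ℝ) v i := by
  conv_lhs => rw [hA.spectral_theorem]
  rw [← map_pow, Unitary.conjStarAlgAut_apply, Matrix.diagonal_pow, Matrix.mul_apply]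
  refine Finset.sum_congr rfl fun i _ => ?_
  rw [Matrix.mul_diagonal]
  simp

/-- Powers of a positive semidefinite matrix with a simple eigenvalue `1` and all other eigenvalues
at most `β < 1` are close to the projection to the eigenspace of `1`. -/
lemma pow_apply_le_of_eigenvalues_le {A : Matrix V V ℝ} (hA : A.IsHermitian) {w : V → ℝ}
    (hw : A.mulVec w = w) (hw0 : w ≠ 0) {β : ℝ} (hβ0 : 0 ≤ β) (hβ : β < 1) (i₀ : V)
    (h0 : ∀ i, i ≠ i₀ → 0 ≤ hA.eigenvalues i) (h1 : ∀ i, i ≠ i₀ → hA.eigenvalues i ≤ β)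
    (t : ℕ) (u v : V) :
    (A ^ t) u v ≤ w u * w v / ∑ x, w x ^ 2 + β ^ t := by
  set U : Matrix V V ℝ := (hA.eigenvectorUnitary : Matrix V V ℝ)
  have hUU : U * U.transpose = 1 := by
    have := Unitary.coe_mul_star_self hA.eigenvectorUnitary
    rwa [Unitary.coe_star, Matrix.star_eq_conjTranspose, Matrix.conjTranspose_eq_transpose_of_trivial] at this
  have hUU' : U.transpose * U = 1 := by
    have := Unitary.coe_star_mul_self hA.eigenvectorUnitary
    rwa [Matrix.star_eq_conjTranspose, Matrix.conjTranspose_eq_transpose_of_trivial] at this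
  let c : V → ℝ := U.transpose.mulVec w
  have hwc : w = U.mulVec c := by
    simp only [c, Matrix.mulVec_mulVec, hUU, Matrix.one_mulVec]
  have heig : ∀ i, A.mulVec (fun u => U u i) = hA.eigenvalues i • fun u => U u i :=
    fun i => hA.mulVec_eigenvectorBasis i
  have hAT : A.transpose = A := by
    have := hA.eq
    rwa [Matrix.conjTranspose_eq_transpose_of_trivial] at this
  have hc : ∀ i, c i = hA.eigenvalues i * c i := by
    intro i
    have hci : c i = (fun u => U u i) ⬝ᵥ w := rfl
    have h2 : (fun u => U u i) ⬝ᵥ A.mulVec w = hA.eigenvalues i * c i := by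
      rw [Matrix.dotProduct_mulVec, ← Matrix.mulVec_transpose, hAT, heig, smul_dotProduct, hci,
        smul_eq_mul]
    rw [← h2, hw, hci]
  -- A fixed vector has no component along eigenvalues below `1`, so `w` is a multiple of column
  -- `i₀`, whose eigenvalue must then be `1`.
  have hc0 : ∀ i, i ≠ i₀ → c i = 0 := by
    intro i hi
    have h2 := hc i
    have h3 := h1 i hi
    have h4 : (1 - hA.eigenvalues i) * c i = 0 := by linarith
    rcases mul_eq_zero.1 h4 with h | h
    · linarith
    · exact h
  have hwu : ∀ u, w u = U u i₀ * c i₀ := by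
    intro u
    conv_lhs => rw [hwc]
    exact Finset.sum_eq_single (f := fun i => U u i * c i) i₀
      (fun i _ hi => by simp [hc0 i hi]) (fun h => absurd (Finset.mem_univ _) h)
  have hci₀ : c i₀ ≠ 0 := fun h => hw0 (funext fun u => by simp [hwu u, h])
  have hlam : hA.eigenvalues i₀ = 1 := mul_right_cancel₀ hci₀ (by rw [one_mul, ← hc i₀])
  have hcol : ∑ x, U x i₀ ^ 2 = 1 := by
    have := congrFun (congrFun hUU' i₀) i₀
    simpa [Matrix.mul_apply, ← pow_two] using this
  have hrow : ∀ x, ∑ i, U x i ^ 2 = 1 := by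
    intro x
    have := congrFun (congrFun hUU x) x
    simpa [Matrix.mul_apply, ← pow_two] using this
  have hsum : ∑ x, w x ^ 2 = c i₀ ^ 2 := by
    simp only [hwu, mul_pow, ← Finset.sum_mul, hcol, one_mul]
  have hmain : w u * w v / ∑ x, w x ^ 2 = U u i₀ * U v i₀ := by
    rw [hsum, hwu u, hwu v]
    field_simp
  rw [pow_apply_eq_sum_eigenvalues hA, ← Finset.add_sum_erase _ _ (Finset.mem_univ i₀), hlam,
    hmain, one_pow, mul_one]
  gcongr
  have hβt : 0 ≤ β ^ t := pow_nonneg hβ0 t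
  -- The inequality `a * b ≤ (a² + b²) / 2` and the unit norm of the rows of `U` keep the error at
  -- `β ^ t`, with no factor of the dimension.
  calc ∑ i ∈ Finset.univ.erase i₀, U u i * hA.eigenvalues i ^ t * U v i
      ≤ ∑ i ∈ Finset.univ.erase i₀, β ^ t * ((U u i ^ 2 + U v i ^ 2) / 2) := by
        refine Finset.sum_le_sum fun i hi => ?_
        have hi := Finset.ne_of_mem_erase hi
        have h2 : hA.eigenvalues i ^ t ≤ β ^ t := pow_le_pow_left₀ (h0 i hi) (h1 i hi) t
        have h3 : 0 ≤ hA.eigenvalues i ^ t := pow_nonneg (h0 i hi) t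
        nlinarith [mul_nonneg h3 (sq_nonneg (U u i - U v i)),
          mul_nonneg (sub_nonneg.2 h2) (add_nonneg (sq_nonneg (U u i)) (sq_nonneg (U v i)))]
    _ ≤ ∑ i, β ^ t * ((U u i ^ 2 + U v i ^ 2) / 2) :=
        Finset.sum_le_sum_of_subset_of_nonneg (Finset.erase_subset _ _)
          fun i _ _ => by positivity
    _ = β ^ t := by
        rw [← Finset.mul_sum, ← Finset.sum_div, Finset.sum_add_distrib, hrow, hrow]
        norm_num

end Spectral

/-! ### Spectrum and mixing of the lazy walk. -/

section LazyWalk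

variable {V : Type*} [Fintype V] [DecidableEq V] {G : SimpleGraph V} [DecidableRel G.Adj]

lemma lazyWalk_nonneg (u v : V) : 0 ≤ lazyWalk G u v := by
  unfold lazyWalk
  split_ifs <;> positivity

lemma sum_erase_lazyWalk {u : V} (hd : 0 < G.degree u) :
    ∑ v ∈ Finset.univ.erase u, lazyWalk G u v = 1 / 2 := by
  have hd' : (G.degree u : ℝ) ≠ 0 := by positivity
  have h1 : ∑ v ∈ Finset.univ.erase u, lazyWalk G u v =
      ∑ v, if G.Adj u v then 1 / (2 * (G.degree u : ℝ)) else 0 := by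
    rw [← Finset.add_sum_erase Finset.univ _ (Finset.mem_univ u), if_neg (G.loopless.irrefl u),
      zero_add]
    refine Finset.sum_congr rfl fun v hv => ?_
    rw [lazyWalk, if_neg (Finset.ne_of_mem_erase hv).symm]
  rw [h1, ← Finset.sum_filter, Finset.sum_const, ← G.neighborFinset_eq_filter,
    G.card_neighborFinset_eq_degree, nsmul_eq_mul]
  field_simp

lemma sum_lazyWalk {u : V} (hd : 0 < G.degree u) : ∑ v, lazyWalk G u v = 1 := by
  rw [← Finset.add_sum_erase _ _ (Finset.mem_univ u), sum_erase_lazyWalk hd, lazyWalk, if_pos rfl]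
  norm_num

/-- The symmetric matrix similar to the transition matrix of the lazy walk. -/
noncomputable def symLazyWalk (G : SimpleGraph V) [DecidableRel G.Adj] : Matrix V V ℝ :=
  Matrix.diagonal (fun u => √(G.degree u : ℝ)) * lazyWalk G *
    Matrix.diagonal (fun u => (√(G.degree u : ℝ))⁻¹)

lemma symLazyWalk_apply (u v : V) :
    symLazyWalk G u v = √(G.degree u : ℝ) * lazyWalk G u v * (√(G.degree v : ℝ))⁻¹ := by
  rw [symLazyWalk, Matrix.mul_diagonal, Matrix.diagonal_mul]

lemma isHermitian_symLazyWalk (hd : ∀ u, 0 < G.degree u) : (symLazyWalk G).IsHermitian := by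
  refine Matrix.IsHermitian.ext fun u v => ?_
  rw [star_trivial, symLazyWalk_apply, symLazyWalk_apply]
  have hu : 0 < √(G.degree u : ℝ) := Real.sqrt_pos.2 (Nat.cast_pos.2 (hd u))
  have hv : 0 < √(G.degree v : ℝ) := Real.sqrt_pos.2 (Nat.cast_pos.2 (hd v))
  have hu2 : √(G.degree u : ℝ) ^ 2 = G.degree u := Real.sq_sqrt (Nat.cast_nonneg _)
  have hv2 : √(G.degree v : ℝ) ^ 2 = G.degree v := Real.sq_sqrt (Nat.cast_nonneg _)
  by_cases huv : u = v
  · subst huv; rfl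
  unfold lazyWalk
  rw [if_neg huv, if_neg (Ne.symm huv)]
  by_cases hadj : G.Adj u v
  · rw [if_pos hadj, if_pos hadj.symm]
    field_simp
    rw [hu2, hv2, div_self (Nat.cast_pos.2 (hd v)).ne', div_self (Nat.cast_pos.2 (hd u)).ne']
  · rw [if_neg hadj, if_neg fun h => hadj h.symm]
    simp

/-- The change of basis relating the two matrices, as a unit. -/
noncomputable def sqrtDegreeUnit (hd : ∀ u, 0 < G.degree u) : (Matrix V V ℝ)ˣ where
  val := Matrix.diagonal (fun u => √(G.degree u : ℝ))
  inv := Matrix.diagonal (fun u => (√(G.degree u : ℝ))⁻¹)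
  val_inv := by
    rw [Matrix.diagonal_mul_diagonal, ← Matrix.diagonal_one]
    congr 1
    ext u
    exact mul_inv_cancel₀ (Real.sqrt_pos.2 (Nat.cast_pos.2 (hd u))).ne'
  inv_val := by
    rw [Matrix.diagonal_mul_diagonal, ← Matrix.diagonal_one]
    congr 1
    ext u
    exact inv_mul_cancel₀ (Real.sqrt_pos.2 (Nat.cast_pos.2 (hd u))).ne'

lemma symLazyWalk_eq_conj (hd : ∀ u, 0 < G.degree u) :
    symLazyWalk G = (sqrtDegreeUnit hd).val * lazyWalk G * (sqrtDegreeUnit hd)⁻¹.val := rfl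

lemma charpoly_symLazyWalk (hd : ∀ u, 0 < G.degree u) :
    (symLazyWalk G).charpoly = (lazyWalk G).charpoly := by
  rw [symLazyWalk_eq_conj hd, Matrix.charpoly_mul_comm, ← mul_assoc, Units.inv_mul, one_mul]

lemma symLazyWalk_pow_apply (hd : ∀ u, 0 < G.degree u) (t : ℕ) (u v : V) :
    (symLazyWalk G ^ t) u v =
      √(G.degree u : ℝ) * (lazyWalk G ^ t) u v * (√(G.degree v : ℝ))⁻¹ := by
  rw [symLazyWalk_eq_conj hd, Units.conj_pow]
  change (Matrix.diagonal _ * _ * Matrix.diagonal _ : Matrix V V ℝ) u v = _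
  rw [Matrix.mul_diagonal, Matrix.diagonal_mul]

lemma symLazyWalk_mulVec_sqrt_degree (hd : ∀ u, 0 < G.degree u) :
    (symLazyWalk G).mulVec (fun u => √(G.degree u : ℝ)) = fun u => √(G.degree u : ℝ) := by
  ext u
  have h1 : ∀ v, symLazyWalk G u v * √(G.degree v : ℝ) = √(G.degree u : ℝ) * lazyWalk G u v := by
    intro v
    rw [symLazyWalk_apply, mul_assoc, inv_mul_cancel₀, mul_one]
    exact (Real.sqrt_pos.2 (Nat.cast_pos.2 (hd v))).ne'
  simp only [Matrix.mulVec, dotProduct, h1, ← Finset.mul_sum, sum_lazyWalk (hd u), mul_one]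

/-- Gershgorin's theorem for the similar matrix `lazyWalk G`: each diagonal entry and each
off-diagonal row sum is `1 / 2`, so every disc is centred at `1 / 2` with radius `1 / 2`. This is
where laziness matters. -/
lemma eigenvalues_symLazyWalk_nonneg (hd : ∀ u, 0 < G.degree u) (i : V) :
    0 ≤ (isHermitian_symLazyWalk hd).eigenvalues i := by
  set hA := isHermitian_symLazyWalk hd
  have hroot : (lazyWalk G).charpoly.IsRoot (hA.eigenvalues i) := by
    rw [← charpoly_symLazyWalk hd, ← Matrix.mem_spectrum_iff_isRoot_charpoly]
    exact hA.eigenvalues_mem_spectrum_real i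
  have heig : Module.End.HasEigenvalue (Matrix.toLin' (lazyWalk G)) (hA.eigenvalues i) := by
    rw [Module.End.hasEigenvalue_iff_isRoot_charpoly, Matrix.charpoly_toLin']
    exact hroot
  obtain ⟨k, hk⟩ := eigenvalue_mem_ball heig
  have hsum : ∑ j ∈ Finset.univ.erase k, ‖lazyWalk G k j‖ = 1 / 2 := by
    rw [← sum_erase_lazyWalk (hd k)]
    exact Finset.sum_congr rfl fun j _ => Real.norm_of_nonneg (lazyWalk_nonneg _ _)
  rw [hsum, Metric.mem_closedBall, Real.dist_eq, lazyWalk, if_pos rfl] at hk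
  have := (abs_le.1 hk).1
  linarith

/-- Similar matrices share a characteristic polynomial, and the sorted roots for a Hermitian matrix
are its ordered eigenvalues, counted from index `0`. -/
lemma secondEigenvalue_lazyWalk (hd : ∀ u, 0 < G.degree u) (hn : 2 ≤ Fintype.card V) :
    secondEigenvalue (lazyWalk G) = (isHermitian_symLazyWalk hd).eigenvalues₀ ⟨1, hn⟩ := by
  have h := (isHermitian_symLazyWalk hd).sort_roots_charpoly_eq_eigenvalues₀
  rw [charpoly_symLazyWalk hd] at h
  have hre : ((lazyWalk G).charpoly.roots.map (RCLike.re : ℝ → ℝ)) =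
      (lazyWalk G).charpoly.roots := by
    simp
  rw [hre] at h
  rw [secondEigenvalue, h, List.getD_eq_getElem _ _ (by rw [List.length_ofFn]; omega)]
  simp

lemma secondEigenvalue_lazyWalk_nonneg (hd : ∀ u, 0 < G.degree u) (hn : 2 ≤ Fintype.card V) :
    0 ≤ secondEigenvalue (lazyWalk G) := by
  rw [secondEigenvalue_lazyWalk hd hn]
  have := eigenvalues_symLazyWalk_nonneg hd
    (Fintype.equivOfCardEq (Fintype.card_fin (Fintype.card V)) ⟨1, hn⟩)
  simpa [Matrix.IsHermitian.eigenvalues] using this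

/-- Mixing of the lazy walk in terms of its second eigenvalue. -/
lemma lazyWalk_pow_apply_le (hd : ∀ u, 0 < G.degree u) (hn : 2 ≤ Fintype.card V)
    (hlt : secondEigenvalue (lazyWalk G) < 1) (t : ℕ) (u v : V) :
    (lazyWalk G ^ t) u v ≤ G.degree v / ∑ x, (G.degree x : ℝ) +
      √((G.degree v : ℝ) / G.degree u) * secondEigenvalue (lazyWalk G) ^ t := by
  have hs : ∀ u, 0 < √(G.degree u : ℝ) := fun u => Real.sqrt_pos.2 (Nat.cast_pos.2 (hd u))
  have hs2 : ∀ u, √(G.degree u : ℝ) ^ 2 = G.degree u := fun u => Real.sq_sqrt (Nat.cast_nonneg _)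
  set hA := isHermitian_symLazyWalk hd
  let e := Fintype.equivOfCardEq (Fintype.card_fin (Fintype.card V))
  have hle : ∀ i, i ≠ e ⟨0, by omega⟩ → hA.eigenvalues i ≤ secondEigenvalue (lazyWalk G) := by
    intro i hi
    rw [secondEigenvalue_lazyWalk hd hn]
    refine hA.eigenvalues₀_antitone ?_
    have h0 : e.symm i ≠ ⟨0, by omega⟩ := fun h => hi (by rw [← h, e.apply_symm_apply])
    have h1 : (e.symm i).val ≠ 0 := fun h => h0 (Fin.ext h)
    exact Fin.le_def.2 (Nat.one_le_iff_ne_zero.2 h1)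
  have hmain := pow_apply_le_of_eigenvalues_le hA (symLazyWalk_mulVec_sqrt_degree hd)
    (fun h => (hs u).ne' (congrFun h u)) (secondEigenvalue_lazyWalk_nonneg hd hn) hlt _
    (fun i _ => eigenvalues_symLazyWalk_nonneg hd i) hle t u v
  simp only [symLazyWalk_pow_apply hd, hs2] at hmain
  have hu := hs u
  have hv := hs v
  have h1 : (lazyWalk G ^ t) u v = √(G.degree v : ℝ) / √(G.degree u : ℝ) *
      (√(G.degree u : ℝ) * (lazyWalk G ^ t) u v * (√(G.degree v : ℝ))⁻¹) := by
    field_simp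
  rw [h1, Real.sqrt_div (Nat.cast_nonneg _)]
  refine (mul_le_mul_of_nonneg_left hmain (by positivity)).trans (le_of_eq ?_)
  rw [mul_add]
  congr 1
  conv_rhs => rw [← hs2 v]
  field_simp

end LazyWalk

/-! ### From deterministic to randomized algorithms. -/

section Randomized

variable {V : Type*}

lemma RandAlg.measurable_cost (A : RandAlg V) (f : V → ℝ) :
    @Measurable _ _ A.mΩ _ fun ω => (A.alg ω).cost f :=
  let _ := A.mΩ
  measurable_to_countable' fun k => A.measurableSet_cost f k

/-- Markov's inequality for the number of queries. -/
lemma RandAlg.measure_lt_cost_le (A : RandAlg V) (f : V → ℝ) (q : ℕ) :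
    A.μ {ω | q < (A.alg ω).cost f} ≤ (⨆ f : V → ℝ, A.expectedCost f) / (q + 1) := by
  let _ := A.mΩ
  have hmeas : Measurable fun ω => ((A.alg ω).cost f : ℝ≥0∞) :=
    (measurable_from_top (f := fun k : ℕ => (k : ℝ≥0∞))).comp (A.measurable_cost f)
  have h1 : {ω | q < (A.alg ω).cost f} ⊆
      {ω | ((q : ℝ≥0∞) + 1) ≤ ((A.alg ω).cost f : ℝ≥0∞)} := by
    intro ω hω
    have : q + 1 ≤ (A.alg ω).cost f := hω
    exact_mod_cast this
  refine (measure_mono h1).trans ((meas_ge_le_lintegral_div hmeas.aemeasurable (by simp)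
    (by simp)).trans ?_)
  exact ENNReal.div_le_div_right (le_iSup (fun f => A.expectedCost f) f) _

lemma RandAlg.measurableSet_success (A : RandAlg V) (f : V → ℝ) (q : ℕ) (v : V) :
    @MeasurableSet _ A.mΩ {ω | (A.alg ω).cost f ≤ q ∧ (A.alg ω).result f = v} :=
  let _ := A.mΩ
  (measurableSet_le (A.measurable_cost f) measurable_const).inter (A.measurableSet_result f v)

variable [Fintype V] [DecidableEq V] {G : SimpleGraph V}

/-- Every algorithm that solves local search makes at least a constant number of queries. -/
lemma RandAlg.one_div_twenty_le_cost (hG : G.Connected) (hn : 2 ≤ Fintype.card V) {A : RandAlg V}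
    (hA : A.SolvesLocalSearch G) : 1 / 20 ≤ ⨆ f : V → ℝ, A.expectedCost f := by
  let _ := A.mΩ
  have := A.isProb
  set R := ⨆ f : V → ℝ, A.expectedCost f
  obtain ⟨a, b, hab⟩ := Fintype.exists_pair_of_one_lt_card (α := V) (by omega)
  -- The constant path cut off at time `0` gives the distance to `c` as input, with `c` as only
  -- local minimum. Without queries the output is the same for `a` and `b`, so the two events are
  -- disjoint.
  let S : V → Set A.Ω := fun c =>
    {ω | (A.alg ω).cost (pathValue (fun u => (G.dist c u : ℝ)) (fun _ => c) 0) ≤ 0 ∧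
      (A.alg ω).result (pathValue (fun u => (G.dist c u : ℝ)) (fun _ => c) 0) = c}
  have hS : ∀ c, 9 / 10 ≤ A.μ (S c) + R := by
    intro c
    refine (hA (pathValue (fun u => (G.dist c u : ℝ)) (fun _ => c) 0)).trans ?_
    have hsub : {ω | IsLocalMinimum G (pathValue (fun u => (G.dist c u : ℝ)) (fun _ => c) 0)
        ((A.alg ω).result (pathValue (fun u => (G.dist c u : ℝ)) (fun _ => c) 0))} ⊆
        S c ∪ {ω | 0 < (A.alg ω).cost (pathValue (fun u => (G.dist c u : ℝ)) (fun _ => c) 0)} := by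
      intro ω hω
      have hres := eq_of_isLocalMinimum hG (x := fun _ => c) (L := 0)
        (fun i hi => absurd hi (Nat.not_lt_zero i)) hω
      rcases Nat.eq_zero_or_pos
        ((A.alg ω).cost (pathValue (fun u => (G.dist c u : ℝ)) (fun _ => c) 0)) with h | h
      · exact Or.inl ⟨h.le, hres⟩
      · exact Or.inr h
    refine (measure_mono hsub).trans ((measure_union_le _ _).trans ?_)
    have := A.measure_lt_cost_le (pathValue (fun u => (G.dist c u : ℝ)) (fun _ => c) 0) 0
    gcongr
    simpa using this
  have hdisj : Disjoint (S a) (S b) := by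
    rw [Set.disjoint_left]
    rintro ω ⟨h1, h2⟩ ⟨h3, h4⟩
    cases hω : A.alg ω with
    | output v =>
      rw [hω] at h2 h4
      exact hab (h2.symm.trans h4)
    | query v next =>
      rw [hω] at h1
      simp [DetAlg.cost] at h1
  have hunion : A.μ (S a) + A.μ (S b) ≤ 1 := by
    rw [← measure_union hdisj (A.measurableSet_success _ _ _)]
    exact prob_le_one
  by_contra hR
  rw [not_le] at hR
  have h : (9 / 10 + 9 / 10 : ℝ≥0∞) ≤ 1 + (1 / 20 + 1 / 20) :=
    calc (9 / 10 + 9 / 10 : ℝ≥0∞) ≤ (A.μ (S a) + R) + (A.μ (S b) + R) := add_le_add (hS a) (hS b)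
      _ = (A.μ (S a) + A.μ (S b)) + (R + R) := by ring
      _ ≤ _ := by gcongr
  have h' := ENNReal.toReal_mono (by simp) h
  rw [ENNReal.toReal_add (by simp [ENNReal.div_eq_top]) (by simp [ENNReal.div_eq_top]),
    ENNReal.toReal_add (by simp) (by simp),
    ENNReal.toReal_add (by simp) (by simp)] at h'
  norm_num [ENNReal.toReal_div] at h'

variable [DecidableRel G.Adj]

/-- If the lazy walk mixes in `t` steps, local search needs many queries. -/
lemma RandAlg.le_cost_of_mixing (hG : G.Connected) (hd : ∀ u, 0 < G.degree u) {A : RandAlg V}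
    (hA : A.SolvesLocalSearch G) {ρ : ℝ} {t q : ℕ}
    (hρ : ∀ d, t ≤ d → ∀ u v, (lazyWalk G ^ d) u v ≤ ρ)
    (hq : (q + 1) * (((q + 1) * t + 1) * (t + 1) * ρ) ≤ 1 / 4) :
    ((q : ℝ≥0∞) + 1) / 2 ≤ ⨆ f : V → ℝ, A.expectedCost f := by
  let _ := A.mΩ
  have := A.isProb
  set R := ⨆ f : V → ℝ, A.expectedCost f
  obtain ⟨x₀⟩ := hG.nonempty
  let w : V → V → ℝ≥0∞ := fun u v => ENNReal.ofReal (lazyWalk G u v)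
  have hw : ∀ u, ∑ v, w u v = 1 := fun u => by
    rw [← ENNReal.ofReal_sum_of_nonneg fun v _ => lazyWalk_nonneg u v, sum_lazyWalk (hd u),
      ENNReal.ofReal_one]
  have hρw : ∀ d, t ≤ d → ∀ m v x,
      walkExp w d m (fun y => if y (m + d) = v then 1 else 0) x ≤ ENNReal.ofReal ρ :=
    fun d hd' m v x => (walkExp_hit_eq lazyWalk_nonneg d m v x).le.trans
      (ENNReal.ofReal_le_ofReal (hρ d hd' _ _))
  set L := (q + 1) * t + 1
  let f : (ℕ → V) → V → ℝ := fun y => pathValue (fun u => (G.dist x₀ u : ℝ)) y L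
  let S : (ℕ → V) → Set A.Ω := fun y =>
    {ω | (A.alg ω).cost (f y) ≤ q ∧ (A.alg ω).result (f y) = y L}
  have hSmeas : ∀ y, MeasurableSet (S y) := fun y => A.measurableSet_success _ _ _
  -- On every single path a correct output comes within `q` queries, except for a loss that Markov's
  -- inequality bounds.
  have hlower : 9 / 10 ≤ walkExp w L 0 (fun y => A.μ (S y) + R / (q + 1)) (fun _ => x₀) := by
    refine le_walkExp hw L 0 _ fun y hy hstep => ?_
    have hy0 : y 0 = x₀ := hy 0 le_rfl
    have hwalk : ∀ i < L, y i = y (i + 1) ∨ G.Adj (y i) (y (i + 1)) := by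
      intro i hi
      have h1 := hstep i (Nat.zero_le _) (by omega)
      by_contra hcon
      push Not at hcon
      exact h1 (by simp [w, lazyWalk, hcon.1, hcon.2])
    refine (hA (f y)).trans ?_
    have hsub : {ω | IsLocalMinimum G (f y) ((A.alg ω).result (f y))} ⊆
        S y ∪ {ω | q < (A.alg ω).cost (f y)} := by
      intro ω hω
      have hres : (A.alg ω).result (f y) = y L :=
        eq_of_isLocalMinimum hG hwalk (by rw [hy0]; exact hω)
      rcases le_or_gt ((A.alg ω).cost (f y)) q with h | h
      · exact Or.inl ⟨h, hres⟩
      · exact Or.inr h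
    refine (measure_mono hsub).trans ((measure_union_le _ _).trans ?_)
    gcongr
    exact A.measure_lt_cost_le (f y) q
  rw [walkExp_add, walkExp_const hw] at hlower
  have hupper : walkExp w L 0 (fun y => A.μ (S y)) (fun _ => x₀) ≤ 1 / 4 := by
    have hint : ∀ y, A.μ (S y) = ∫⁻ ω, (S y).indicator 1 ω ∂A.μ :=
      fun y => (lintegral_indicator_one (hSmeas y)).symm
    simp only [hint]
    -- Yao's principle: after the exchange, the deterministic bound applies for each coin toss.
    rw [(walkExp_lintegral A.μ (fun y => measurable_one.indicator (hSmeas y)) L 0 _).2]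
    refine (lintegral_mono (g := fun _ => (1 / 4 : ℝ≥0∞)) fun ω => ?_).trans (by simp)
    have hdet := walkExp_success_le hw hρw (fun u => (G.dist x₀ u : ℝ)) (A.alg ω)
      (Nat.lt_succ_self ((q + 1) * t)) (fun _ => x₀)
    refine le_trans (le_of_eq ?_) (hdet.trans ?_)
    · congr 1
      ext y
      simp only [Set.indicator_apply, S, Set.mem_ofPred_eq, Pi.one_apply]
      rfl
    · have h4 : (1 / 4 : ℝ≥0∞) = ENNReal.ofReal (1 / 4) := by
        rw [ENNReal.ofReal_div_of_pos (by norm_num)]; simp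
      rw [h4]
      refine le_trans (le_of_eq ?_) (ENNReal.ofReal_le_ofReal hq)
      rw [ENNReal.ofReal_mul (by positivity), ENNReal.ofReal_mul (by positivity),
        ENNReal.ofReal_mul (by positivity)]
      norm_cast
  by_contra hR
  rw [not_le] at hR
  have h2 : R / (q + 1) ≤ 1 / 2 := by
    refine ENNReal.div_le_of_le_mul (hR.le.trans (le_of_eq ?_))
    rw [ENNReal.div_eq_inv_mul, one_div]
  have h : (9 / 10 : ℝ≥0∞) ≤ 1 / 4 + 1 / 2 := hlower.trans (add_le_add hupper h2)
  have h' := ENNReal.toReal_mono (by simp) h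
  rw [ENNReal.toReal_add (by simp) (by simp)] at h'
  norm_num [ENNReal.toReal_div] at h'

end Randomized

/-! ### The mixing time on almost regular graphs. -/

section Mixing

variable {V : Type*} [Fintype V] [DecidableEq V] {G : SimpleGraph V} [DecidableRel G.Adj]

/-- The lazy walk on an almost regular graph mixes within `log n / (1 - λ₂)` steps. -/
lemma lazyWalk_pow_apply_le_two_mul_div {C : ℝ} (hC1 : 1 ≤ C) (hn : 2 ≤ Fintype.card V)
    (hmin : 0 < G.minDegree) (hC : (G.maxDegree : ℝ) ≤ C * G.minDegree)
    (hlt : secondEigenvalue (lazyWalk G) < 1) {d : ℕ}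
    (hd : Real.log (Fintype.card V) / (1 - secondEigenvalue (lazyWalk G)) ≤ d) (u v : V) :
    (lazyWalk G ^ d) u v ≤ 2 * C / Fintype.card V := by
  have hdeg : ∀ u, 0 < G.degree u := fun u => hmin.trans_le (G.minDegree_le_degree u)
  set l := secondEigenvalue (lazyWalk G)
  have hl0 : 0 ≤ l := secondEigenvalue_lazyWalk_nonneg hdeg hn
  have hn0 : (0 : ℝ) < Fintype.card V := by exact_mod_cast (by omega : 0 < Fintype.card V)
  have hmin' : (0 : ℝ) < G.minDegree := Nat.cast_pos.2 hmin
  have hge : ∀ x, (G.minDegree : ℝ) ≤ G.degree x :=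
    fun x => Nat.cast_le.2 (G.minDegree_le_degree x)
  have hle : (G.degree v : ℝ) ≤ C * G.minDegree :=
    (Nat.cast_le.2 (G.degree_le_maxDegree v)).trans hC
  have hsum : Fintype.card V * (G.minDegree : ℝ) ≤ ∑ x, (G.degree x : ℝ) := by
    have := Finset.card_nsmul_le_sum Finset.univ (fun x => (G.degree x : ℝ)) _ fun x _ => hge x
    simpa using this
  have h1 : (G.degree v : ℝ) / ∑ x, (G.degree x : ℝ) ≤ C / Fintype.card V := by
    rw [div_le_div_iff₀ ((by positivity : (0 : ℝ) < _).trans_le hsum) hn0]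
    calc (G.degree v : ℝ) * Fintype.card V ≤ C * G.minDegree * Fintype.card V := by gcongr
      _ = C * (Fintype.card V * G.minDegree) := by ring
      _ ≤ _ := by gcongr
  have h2 : √((G.degree v : ℝ) / G.degree u) ≤ C := by
    refine Real.sqrt_le_iff.2 ⟨by linarith, ?_⟩
    calc (G.degree v : ℝ) / G.degree u ≤ C := by
          rw [div_le_iff₀ (Nat.cast_pos.2 (hdeg u))]
          exact hle.trans (mul_le_mul_of_nonneg_left (hge u) (by linarith))
      _ ≤ C ^ 2 := by nlinarith
  -- From `l ≤ exp (-(1 - l))` and `d * (1 - l) ≥ log n`.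
  have h3 : l ^ d ≤ 1 / Fintype.card V := by
    have h4 : l ≤ Real.exp (-(1 - l)) := by
      have := Real.add_one_le_exp (-(1 - l))
      linarith
    calc l ^ d ≤ Real.exp (-(1 - l)) ^ d := pow_le_pow_left₀ hl0 h4 d
      _ = Real.exp (-(d * (1 - l))) := by rw [← Real.exp_nat_mul]; ring_nf
      _ ≤ Real.exp (-Real.log (Fintype.card V)) := by
          rw [div_le_iff₀ (by linarith)] at hd
          gcongr
      _ = 1 / Fintype.card V := by rw [Real.exp_neg, Real.exp_log hn0, one_div]
  calc (lazyWalk G ^ d) u v ≤ _ := lazyWalk_pow_apply_le hdeg hn hlt d u v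
    _ ≤ C / Fintype.card V + C * (1 / Fintype.card V) :=
        add_le_add h1 (mul_le_mul h2 h3 (pow_nonneg hl0 d) (by linarith))
    _ = _ := by ring

end Mixing

end LocalSearch

/-! ### Choice of parameters. -/

theorem corollary2 (C : ℝ) (hC : 0 < C) :
    ∃ c : ℝ, 0 < c ∧
      ∀ (V : Type*) [Fintype V] [DecidableEq V] (G : SimpleGraph V) [DecidableRel G.Adj],
        2 ≤ Fintype.card V → G.Connected →
        (G.maxDegree : ℝ) / (G.minDegree : ℝ) ≤ C →
        ENNReal.ofReal
            (c * ((1 - LocalSearch.secondEigenvalue (LocalSearch.lazyWalk G)) *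
              √(Fintype.card V : ℝ) / Real.log (Fintype.card V : ℝ))) ≤
          LocalSearch.randQueryComplexity G := by
  -- Here `480 = 4 * 3 * 40`: `4` from the definition of `Y`, `3` from rounding `t` up, and `40`
  -- from `Y / 40 ≤ 1 / 20` when `Y < 2`.
  refine ⟨1 / (480 * √C), by positivity, fun V _ _ G _ hn hG hratio => ?_⟩
  have : Nontrivial V := Fintype.one_lt_card_iff_nontrivial.1 hn
  have hmin : 0 < G.minDegree := hG.preconnected.minDegree_pos_of_nontrivial
  have hmin' : (0 : ℝ) < G.minDegree := Nat.cast_pos.2 hmin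
  have hdeg : ∀ u, 0 < G.degree u := fun u => hmin.trans_le (G.minDegree_le_degree u)
  have hCmax : (G.maxDegree : ℝ) ≤ C * G.minDegree := (div_le_iff₀ hmin').1 hratio
  have hC1 : 1 ≤ C := by
    obtain ⟨u⟩ := hG.nonempty
    have h1 : (G.minDegree : ℝ) ≤ G.maxDegree :=
      Nat.cast_le.2 ((G.minDegree_le_degree u).trans (G.degree_le_maxDegree u))
    exact ((one_le_div hmin').2 h1).trans hratio
  refine le_iInf₂ fun A hA => ?_
  set n : ℝ := (Fintype.card V : ℝ) with hndef
  set l := LocalSearch.secondEigenvalue (LocalSearch.lazyWalk G) with hl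
  have hn2 : (2 : ℝ) ≤ n := by rw [hndef]; exact_mod_cast hn
  have hlog : 1 / 2 ≤ Real.log n := by
    have h1 := Real.log_le_log (by norm_num) hn2
    have h2 := Real.log_two_gt_d9
    linarith
  -- If `l ≥ 1` the claimed bound is nonpositive, so simplicity of the eigenvalue `1` need not be
  -- proved.
  rcases le_or_gt 1 l with hge | hlt
  · rw [ENNReal.ofReal_of_nonpos]
    · exact zero_le
    · refine mul_nonpos_of_nonneg_of_nonpos (by positivity)
        (div_nonpos_of_nonpos_of_nonneg ?_ (by linarith))
      exact mul_nonpos_of_nonpos_of_nonneg (by linarith) (Real.sqrt_nonneg _)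
  have hl0 : 0 ≤ l := LocalSearch.secondEigenvalue_lazyWalk_nonneg hdeg hn
  set t : ℕ := ⌈Real.log n / (1 - l)⌉₊ with ht
  have htle : Real.log n / (1 - l) ≤ t := Nat.le_ceil _
  have hgap : 1 / 2 ≤ Real.log n / (1 - l) := hlog.trans (le_div_self (by linarith) (by linarith)
    (by linarith))
  have ht1 : (1 : ℝ) ≤ t := by
    have : 0 < t := Nat.ceil_pos.2 (by linarith)
    exact_mod_cast this
  have htlt : (t : ℝ) ≤ 3 * (Real.log n / (1 - l)) := by
    have := Nat.ceil_lt_add_one (show 0 ≤ Real.log n / (1 - l) by linarith)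
    linarith
  have hsC : 0 < √C := Real.sqrt_pos.2 hC
  -- Solves `Y ^ 2 * (4 * t ^ 2 * C / n) = 1 / 4`, the threshold required by `le_cost_of_mixing`.
  set Y : ℝ := √n / (4 * √C * t) with hY
  have hY0 : 0 ≤ Y := by positivity
  have hbound : 1 / (480 * √C) * ((1 - l) * √n / Real.log n) ≤ Y / 40 := by
    have h1 : (1 - l) / Real.log n ≤ 3 / t := by
      rw [div_le_div_iff₀ (by linarith) (by linarith)]
      have := mul_le_mul_of_nonneg_right htlt (show 0 ≤ 1 - l by linarith)
      rw [mul_assoc, div_mul_cancel₀ _ (by linarith)] at this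
      linarith
    calc 1 / (480 * √C) * ((1 - l) * √n / Real.log n)
        = 1 / (480 * √C) * √n * ((1 - l) / Real.log n) := by ring
      _ ≤ 1 / (480 * √C) * √n * (3 / t) := by gcongr
      _ = Y / 40 := by rw [hY]; field_simp; norm_num
  refine (ENNReal.ofReal_le_ofReal hbound).trans ?_
  rcases lt_or_ge Y 2 with hY2 | hY2
  · refine le_trans ?_ (LocalSearch.RandAlg.one_div_twenty_le_cost hG hn hA)
    have h20 : (1 / 20 : ℝ≥0∞) = ENNReal.ofReal (1 / 20) := by
      rw [ENNReal.ofReal_div_of_pos (by norm_num)]; simp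
    rw [h20]
    exact ENNReal.ofReal_le_ofReal (by linarith)
  -- The shift by `2` gives room for `(q + 1) * t + 1 ≤ (q + 2) * t`, valid as `t ≥ 1`.
  obtain ⟨q, hq⟩ : ∃ q, ⌊Y⌋₊ = q + 2 :=
    Nat.exists_eq_add_of_le' (Nat.le_floor (by exact_mod_cast hY2))
  have hqY : (q : ℝ) + 2 ≤ Y := by
    have := Nat.floor_le hY0
    rw [hq] at this
    exact_mod_cast this
  have hYq : Y < q + 3 := by
    have := Nat.lt_floor_add_one Y
    rw [hq] at this
    push_cast at this
    linarith
  have hq0 : (0 : ℝ) ≤ q := Nat.cast_nonneg q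
  have hcost := LocalSearch.RandAlg.le_cost_of_mixing hG hdeg hA (ρ := 2 * C / n) (t := t) (q := q)
    (fun d hd u v => LocalSearch.lazyWalk_pow_apply_le_two_mul_div hC1 hn hmin hCmax hlt
      (htle.trans (Nat.cast_le.2 hd)) u v) (by
    have h1 : ((q : ℝ) + 1) * t + 1 ≤ (q + 2) * t := by linarith
    calc ((q : ℝ) + 1) * (((q + 1) * t + 1) * (t + 1) * (2 * C / n))
        ≤ (q + 2) * (((q + 2) * t) * (t + t) * (2 * C / n)) := by gcongr; linarith
      _ = (q + 2) ^ 2 * (4 * t ^ 2 * C / n) := by ring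
      _ ≤ Y ^ 2 * (4 * t ^ 2 * C / n) := by gcongr
      _ = 1 / 4 := by
          rw [hY, div_pow, mul_pow, mul_pow, Real.sq_sqrt (by linarith), Real.sq_sqrt hC.le]
          field_simp)
  refine le_trans ?_ hcost
  have h2 : ((q : ℝ≥0∞) + 1) / 2 = ENNReal.ofReal (((q : ℝ) + 1) / 2) := by
    rw [ENNReal.ofReal_div_of_pos (by norm_num), ENNReal.ofReal_add hq0 zero_le_one]
    simp
  rw [h2]
  exact ENNReal.ofReal_le_ofReal (by linarith)
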